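/- For $\theta>0$ and $p<1$ let the zero-inflated Poisson distribution $\mathrm{ZIP}(\theta,p)$ have the probabilities $$f_{\theta,p}(0)=p+(1-p)e^{-\theta/(1-p)},\qquad f_{\theta,p}(k)=e^{-\theta/(1-p)}\frac{\theta^k}{k!\,(1-p)^{k-1}}\quad(k\ge 1),$$ where $(\theta,p)$ ranges over the set $\Theta$ of all pairs with $\theta>0$, $p<1$ and $f_{\theta,p}(0)\ge 0$ (so every $p\in[0,1)$ is allowed, and also those negative $p$ for which $f_{\theta,p}$ is still a probability distribution). Let $\mathrm{E}_{\theta,p}(Y_{2:2})$ be the expected maximum of two independent $\mathrm{ZIP}(\theta,p)$ variables. Given a sample $Y_1,\dots,Y_n$, let $(\hat\theta,\hat p)=(\hat\theta_n,\hat p_n)$ be the maximum likelihood estimate, i.e. a maximizer of $\prod_{i=1}^n f_{\theta,p}(Y_i)$ over $(\theta,p)\in\Theta$ (with arbitrary values for those samples for which no maximizer exists), and put $$\Delta_{2:2}=\mathrm{E}_{\hat\theta,\hat p}(Y_{2:2})-\mathrm{E}_{\hat\theta,0}(Y_{2:2}).$$ **Theorem.** Let $\theta>0$ and let $Y_1,Y_2,\dots$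 be independent with distribution $\mathrm{ZIP}(\theta,0)$, i.e. Poisson with mean $\theta$ (the null hypothesis $p=0$). Then $$\sqrt n\,\frac{\Delta_{2:2}}{\sigma(\hat\theta)}\longrightarrow_d N(0,1),\qquad n\to\infty,$$ where $\sigma(\theta)\ge 0$ is given by $$\sigma^2(\theta)=\frac{\theta^2\left(1-e^{-2\theta}\left[(1+\theta)I_0(2\theta)+I_1(2\theta)-\theta I_2(2\theta)\right]\right)^2}{e^{\theta}-1-\theta}$$ and $I_0,I_1,I_2$ are the modified Bessel functions of the first kind. -/

import Mathlib

open MeasureTheory ProbabilityTheory Filter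
open scoped Nat

noncomputable section

namespace ZIP

/-- The modified Bessel function of the first kind `I_ν(x)` of order `ν ∈ ℕ`, by its (everywhere
convergent) power series. -/
def besselI (ν : ℕ) (x : ℝ) : ℝ :=
  ∑' m : ℕ, (x / 2) ^ (2 * m + ν) / ((m ! : ℝ) * ((m + ν)! : ℝ))

/-- The probabilities of the zero-inflated Poisson distribution with mean `θ` and proportion `p`
of structural zeros. -/
def prob (θ p : ℝ) : ℕ → ℝ
  | 0 => p + (1 - p) * Real.exp (-θ / (1 - p))
  | k + 1 => Real.exp (-θ / (1 - p)) * θ ^ (k + 1) / (((k + 1)! : ℝ) * (1 - p) ^ k)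

/-- The law on `ℕ` with point masses `prob θ p k`. -/
def law (θ p : ℝ) : Measure ℕ :=
  Measure.sum fun k => ENNReal.ofReal (prob θ p k) • Measure.dirac k

/-- `(θ, p)` is a parameter value: `θ > 0`, `p < 1` and the numbers `prob θ p k` are probabilities
(for `k ≥ 1` they are automatically positive). Every `p ∈ [0, 1)` is covered; negative values
of `p` (zero deflation) are covered as long as the mass at zero is nonnegative. -/
def IsParam (θ p : ℝ) : Prop :=
  0 < θ ∧ p < 1 ∧ 0 ≤ prob θ p 0

/-- The likelihood of `(θ, p)` for the observed counts `y₁, …, yₙ`. -/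
def likelihood {n : ℕ} (y : Fin n → ℕ) (θ p : ℝ) : ℝ :=
  ∏ i, prob θ p (y i)

/-- `(θ, p)` is a maximum likelihood estimate for the observed counts `y₁, …, yₙ`. -/
def IsMLE {n : ℕ} (y : Fin n → ℕ) (θ p : ℝ) : Prop :=
  IsParam θ p ∧ ∀ θ' p', IsParam θ' p' → likelihood y θ' p' ≤ likelihood y θ p

/-- `E_{θ,p}(Y_{2:2})`: the expected maximum of two independent variables with law `law θ p`. -/
def expMax2 (θ p : ℝ) : ℝ :=
  ∫ y : ℕ × ℕ, ((max y.1 y.2 : ℕ) : ℝ) ∂((law θ p).prod (law θ p))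

/-- The discrepancy `Δ_{2:2}` for testing `p = 0`, as a function of the estimates. -/
def discrepancy (θ p : ℝ) : ℝ :=
  expMax2 θ p - expMax2 θ 0

/-- The asymptotic standard deviation `σ(θ)`. -/
def sigma (θ : ℝ) : ℝ :=
  Real.sqrt (θ ^ 2 *
    (1 - Real.exp (-2 * θ) *
      ((1 + θ) * besselI 0 (2 * θ) + besselI 1 (2 * θ) - θ * besselI 2 (2 * θ))) ^ 2 /
    (Real.exp θ - 1 - θ))

end ZIP

end

/-! Since max + min is the sum, the expected maximum is 2t - (1-p)² M(t/(1-p)), where M =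
`poissonMin`. With C(l) = M(l)/l² and λ = t/(1-p), the discrepancy is t² (C(t) - C(λ))
(`discrepancy_eq`). Differentiating the tail series gives C' = -κ/l², where κ = 1 - P(X=X') -
2P(X'=X+1) > 0 for independent Poisson X, X'. The Bessel recurrence identifies κ with the bracket in
σ (`sigma_eq`).

In the coordinates q = f(0) and λ the likelihood splits into a Bernoulli factor for "zero or not"
and a zero-truncated Poisson factor. Each has a unique maximizer, so t̂ is the sample mean and λ̂
solves `truncMean` λ̂ = mean / (proportion of nonzeros) (`mle_exists_and_eq`).

Hence near (θ, 1 - e^{-θ}) the standardized discrepancy is a function F of the sample mean and the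
nonzero proportion, with F = 0 at that point (`exists_discrepancy_linearization`). Its derivative
there averages `influence`, which has variance 1. Chebyshev's inequality and the delta method remove
the remainder, and the central limit theorem gives N(0,1). -/

noncomputable section

namespace ZIP

/-! ### Poisson probabilities and tails. -/

/-- The Poisson probabilities with real parameter `l`. -/
def poissonProb (l : ℝ) (k : ℕ) : ℝ :=
  Real.exp (-l) * l ^ k / (k ! : ℝ)

/-- The upper tail `P(X ≥ k)` of a Poisson variable with parameter `l`. -/
def poissonTail (l : ℝ) (k : ℕ) : ℝ :=
  1 - ∑ i ∈ Finset.range k, poissonProb l i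

/-- The expected minimum of two independent Poisson variables with parameter `l`. -/
def poissonMin (l : ℝ) : ℝ :=
  ∑' k, poissonTail l (k + 1) ^ 2

theorem summable_pow_div_factorial (l : ℝ) : Summable fun k : ℕ => l ^ k / (k ! : ℝ) :=
  Real.summable_pow_div_factorial l

theorem hasSum_poissonProb (l : ℝ) : HasSum (poissonProb l) 1 := by
  have h := (NormedSpace.expSeries_div_hasSum_exp (𝔸 := ℝ) l).mul_left (Real.exp (-l))
  rw [← Real.exp_eq_exp_ℝ, ← Real.exp_add, neg_add_cancel, Real.exp_zero] at h
  simp_rw [← mul_div_assoc] at h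
  exact h

theorem poissonProb_nonneg {l : ℝ} (hl : 0 ≤ l) (k : ℕ) : 0 ≤ poissonProb l k := by
  unfold poissonProb; positivity

theorem poissonProb_pos {l : ℝ} (hl : 0 < l) (k : ℕ) : 0 < poissonProb l k := by
  unfold poissonProb; positivity

theorem poissonProb_le_pow_div {l : ℝ} (hl : 0 ≤ l) (k : ℕ) :
    poissonProb l k ≤ l ^ k / (k ! : ℝ) := by
  unfold poissonProb
  rw [mul_div_assoc]
  exact mul_le_of_le_one_left (by positivity) (Real.exp_le_one_iff.2 (by linarith))

theorem succ_mul_poissonProb_succ (l : ℝ) (k : ℕ) :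
    ((k : ℝ) + 1) * poissonProb l (k + 1) = l * poissonProb l k := by
  unfold poissonProb
  rw [Nat.factorial_succ]
  push_cast
  field_simp
  ring

theorem poissonTail_zero (l : ℝ) : poissonTail l 0 = 1 := by simp [poissonTail]

theorem poissonTail_succ (l : ℝ) (k : ℕ) :
    poissonTail l (k + 1) = poissonTail l k - poissonProb l k := by
  unfold poissonTail; rw [Finset.sum_range_succ]; ring

theorem poissonTail_nonneg {l : ℝ} (hl : 0 ≤ l) (k : ℕ) : 0 ≤ poissonTail l k := by
  have := sum_le_hasSum (Finset.range k) (fun i _ => poissonProb_nonneg hl i) (hasSum_poissonProb l)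
  unfold poissonTail; linarith

theorem poissonTail_pos {l : ℝ} (hl : 0 < l) (k : ℕ) : 0 < poissonTail l k := by
  have h1 := poissonTail_succ l k
  have h2 := poissonTail_nonneg hl.le (k + 1)
  have h3 := poissonProb_pos hl k
  linarith

theorem poissonTail_le_one {l : ℝ} (hl : 0 ≤ l) (k : ℕ) : poissonTail l k ≤ 1 := by
  have := Finset.sum_nonneg (s := Finset.range k) (fun i _ => poissonProb_nonneg hl i)
  unfold poissonTail; linarith

theorem hasDerivAt_poissonProb_zero (l : ℝ) :
    HasDerivAt (fun x => poissonProb x 0) (-poissonProb l 0) l := by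
  simpa [poissonProb] using (hasDerivAt_neg l).exp

theorem hasDerivAt_poissonProb_succ (l : ℝ) (k : ℕ) :
    HasDerivAt (fun x => poissonProb x (k + 1)) (poissonProb l k - poissonProb l (k + 1)) l := by
  have h := (((hasDerivAt_neg l).exp).mul (hasDerivAt_pow (k + 1) l)).div_const ((k + 1)! : ℝ)
  refine h.congr_deriv ?_
  unfold poissonProb
  rw [Nat.factorial_succ]
  push_cast
  field_simp
  ring

/-- The derivatives of the point masses are successive differences, so their sum telescopes. -/
theorem hasDerivAt_poissonTail (l : ℝ) (k : ℕ) :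
    HasDerivAt (fun x => poissonTail x (k + 1)) (poissonProb l k) l := by
  induction k with
  | zero =>
    have : (fun x => poissonTail x (0 + 1)) = fun x => 1 - poissonProb x 0 := by
      funext x; rw [poissonTail_succ, poissonTail_zero]
    rw [this]
    simpa using (hasDerivAt_poissonProb_zero l).const_sub 1
  | succ k ih =>
    have : (fun x => poissonTail x (k + 1 + 1)) =
        fun x => poissonTail x (k + 1) - poissonProb x (k + 1) := by
      funext x; rw [poissonTail_succ]
    rw [this]
    exact (ih.sub (hasDerivAt_poissonProb_succ l k)).congr_deriv (by ring)

theorem poissonTail_zero_succ (k : ℕ) : poissonTail 0 (k + 1) = 0 := by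
  unfold poissonTail
  rw [Finset.sum_range_succ']
  simp [poissonProb]

/-- For k ≥ 1 both sides vanish at l = 0, and the derivatives are ordered. This supplies the
summable majorant for the tail series. -/
theorem poissonTail_le_pow_div {l : ℝ} (hl : 0 ≤ l) (k : ℕ) :
    poissonTail l k ≤ l ^ k / (k ! : ℝ) := by
  cases k with
  | zero => simp [poissonTail_zero]
  | succ k =>
    have hd : ∀ x : ℝ, HasDerivAt
        (fun x => x ^ (k + 1) / ((k + 1)! : ℝ) - poissonTail x (k + 1))
        (x ^ k / (k ! : ℝ) - poissonProb x k) x := fun x => by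
      refine (((hasDerivAt_pow (k + 1) x).div_const ((k + 1)! : ℝ)).sub
        (hasDerivAt_poissonTail x k)).congr_deriv ?_
      rw [Nat.factorial_succ]
      push_cast
      field_simp
    have hm : MonotoneOn (fun x => x ^ (k + 1) / ((k + 1)! : ℝ) - poissonTail x (k + 1))
        (Set.Ici 0) := by
      refine monotoneOn_of_deriv_nonneg (convex_Ici 0)
        (fun x _ => (hd x).continuousAt.continuousWithinAt)
        (fun x _ => (hd x).differentiableAt.differentiableWithinAt) fun x hx => ?_
      rw [interior_Ici] at hx
      rw [(hd x).deriv]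
      exact sub_nonneg.2 (poissonProb_le_pow_div (le_of_lt hx) k)
    have := hm (Set.mem_Ici.2 le_rfl) (Set.mem_Ici.2 hl) hl
    simp only [poissonTail_zero_succ] at this
    simp at this
    linarith

theorem tendsto_poissonTail {l : ℝ} (hl : 0 ≤ l) :
    Tendsto (poissonTail l) atTop (nhds 0) :=
  squeeze_zero (poissonTail_nonneg hl) (poissonTail_le_pow_div hl)
    (summable_pow_div_factorial l).tendsto_atTop_zero

theorem summable_poissonTail_sq {l : ℝ} (hl : 0 ≤ l) :
    Summable fun k => poissonTail l (k + 1) ^ 2 := by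
  refine Summable.of_nonneg_of_le (fun k => sq_nonneg _) (fun k => ?_)
    ((summable_nat_add_iff 1).2 (summable_pow_div_factorial l))
  refine le_trans ?_ (poissonTail_le_pow_div hl (k + 1))
  have h0 := poissonTail_nonneg hl (k + 1)
  have h1 := poissonTail_le_one hl (k + 1)
  nlinarith

/-- Each mass is a difference of consecutive tails, so the terms are differences of squared tails
and telescope. -/
theorem hasSum_poissonProb_mul_tail_add {l : ℝ} (hl : 0 ≤ l) :
    HasSum (fun k => poissonProb l k * (poissonTail l k + poissonTail l (k + 1))) 1 := by
  rw [hasSum_iff_tendsto_nat_of_nonneg fun k => mul_nonneg (poissonProb_nonneg hl k)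
    (add_nonneg (poissonTail_nonneg hl _) (poissonTail_nonneg hl _))]
  have h : ∀ n, ∑ k ∈ Finset.range n, poissonProb l k * (poissonTail l k + poissonTail l (k + 1)) =
      1 - poissonTail l n ^ 2 := fun n => by
    induction n with
    | zero => simp [poissonTail_zero]
    | succ n ih => rw [Finset.sum_range_succ, ih, poissonTail_succ]; ring
  simp_rw [h]
  simpa using ((tendsto_poissonTail hl).pow 2).const_sub 1

theorem summable_poissonProb_mul {l : ℝ} (hl : 0 ≤ l) {f : ℕ → ℝ} (h0 : ∀ k, 0 ≤ f k)
    (h1 : ∀ k, f k ≤ 1) : Summable fun k => poissonProb l k * f k :=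
  Summable.of_nonneg_of_le (fun k => mul_nonneg (poissonProb_nonneg hl k) (h0 k))
    (fun k => mul_le_of_le_one_right (poissonProb_nonneg hl k) (h1 k)) (hasSum_poissonProb l).summable

theorem poissonProb_le_one {l : ℝ} (hl : 0 ≤ l) (k : ℕ) : poissonProb l k ≤ 1 := by
  have h1 := poissonTail_succ l k
  have h2 := poissonTail_nonneg hl (k + 1)
  have h3 := poissonTail_le_one hl k
  linarith

/-! ### The expected minimum and its derivative. -/

/-- The probability that the difference of two independent Poisson variables equals `d`. -/
def skellamProb (l : ℝ) (d : ℕ) : ℝ := ∑' k, poissonProb l k * poissonProb l (k + d)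

theorem hasSum_skellamProb {l : ℝ} (hl : 0 ≤ l) (d : ℕ) :
    HasSum (fun k => poissonProb l k * poissonProb l (k + d)) (skellamProb l d) :=
  (summable_poissonProb_mul hl (fun k => poissonProb_nonneg hl (k + d))
    fun k => poissonProb_le_one hl (k + d)).hasSum

/-- By symmetry, 2P(X > X') = P(X ≠ X'). -/
theorem hasSum_two_mul_poissonTail_mul {l : ℝ} (hl : 0 ≤ l) :
    HasSum (fun k => 2 * poissonTail l (k + 1) * poissonProb l k) (1 - skellamProb l 0) := by
  refine ((hasSum_poissonProb_mul_tail_add hl).sub (hasSum_skellamProb hl 0)).congr_fun ?_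
  intro k
  rw [poissonTail_succ, Nat.add_zero]; ring

theorem hasDerivAt_poissonMin {l : ℝ} (hl : 0 < l) :
    HasDerivAt poissonMin (1 - skellamProb l 0) l := by
  rw [← (hasSum_two_mul_poissonTail_mul hl.le).tsum_eq]
  refine hasDerivAt_tsum_of_isPreconnected (t := Set.Ioo 0 (l + 1)) (y₀ := l)
    (u := fun k => 2 * ((l + 1) ^ k / (k ! : ℝ)))
    (g := fun k x => poissonTail x (k + 1) ^ 2)
    (g' := fun k x => 2 * poissonTail x (k + 1) * poissonProb x k)
    ((summable_pow_div_factorial (l + 1)).mul_left 2) isOpen_Ioo isPreconnected_Ioo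
    (fun k x _ => ?_) (fun k x hx => ?_) ⟨hl, by linarith⟩ (summable_poissonTail_sq hl.le)
    ⟨hl, by linarith⟩
  · exact ((hasDerivAt_poissonTail x k).pow 2).congr_deriv (by simp)
  · have h0 := hx.1.le
    have ht := poissonTail_nonneg h0 (k + 1)
    have ht1 := poissonTail_le_one h0 (k + 1)
    have hp := poissonProb_nonneg h0 k
    have hp1 : poissonProb x k ≤ (l + 1) ^ k / (k ! : ℝ) := by
      refine (poissonProb_le_pow_div h0 k).trans ?_
      have := hx.2.le
      gcongr
    rw [Real.norm_of_nonneg (by positivity)]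
    nlinarith

/-- Abel summation of the squared tails produces weights k+1, which (k+1) p_{k+1} = l p_k absorbs.
-/
theorem poissonMin_eq {l : ℝ} (hl : 0 ≤ l) :
    poissonMin l = l * (1 - skellamProb l 0 - skellamProb l 1) := by
  have h1 : HasSum (fun k : ℕ => ((k : ℝ) + 1) * (poissonTail l (k + 1) ^ 2 - poissonTail l (k + 2) ^ 2))
      (l * (1 - skellamProb l 0 - skellamProb l 1)) := by
    refine (((hasSum_two_mul_poissonTail_mul hl).sub
      (hasSum_skellamProb hl 1)).mul_left l).congr_fun fun k => ?_
    have h := succ_mul_poissonProb_succ l k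
    rw [poissonTail_succ l (k + 1)]
    linear_combination (2 * poissonTail l (k + 1) - poissonProb l (k + 1)) * h
  -- The boundary term of the Abel summation.
  have h2 : Tendsto (fun n : ℕ => (n : ℝ) * poissonTail l (n + 1) ^ 2) atTop (nhds 0) := by
    refine squeeze_zero (g := fun n : ℕ => l * (l ^ n / (n ! : ℝ))) (fun n => by positivity)
      (fun n => ?_) ?_
    · have h0 := poissonTail_nonneg hl (n + 1)
      have h1 := poissonTail_le_one hl (n + 1)
      have h2 := poissonTail_le_pow_div hl (n + 1)
      have h3 : (n : ℝ) * (l ^ (n + 1) / ((n + 1)! : ℝ)) ≤ l * (l ^ n / (n ! : ℝ)) := by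
        have : l * (l ^ n / (n ! : ℝ)) = ((n : ℝ) + 1) * (l ^ (n + 1) / ((n + 1)! : ℝ)) := by
          rw [Nat.factorial_succ]; push_cast; field_simp; ring
        rw [this]
        gcongr
        linarith
      refine le_trans ?_ h3
      gcongr
      nlinarith
    · simpa using (summable_pow_div_factorial l).tendsto_atTop_zero.const_mul l
  have h3 : ∀ n : ℕ, ∑ k ∈ Finset.range n, poissonTail l (k + 1) ^ 2 =
      ∑ k ∈ Finset.range n, ((k : ℝ) + 1) * (poissonTail l (k + 1) ^ 2 - poissonTail l (k + 2) ^ 2) +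
        (n : ℝ) * poissonTail l (n + 1) ^ 2 := fun n => by
    induction n with
    | zero => simp
    | succ n ih =>
      rw [Finset.sum_range_succ, ih, Finset.sum_range_succ]; push_cast; ring
  have h4 := (summable_poissonTail_sq hl).hasSum.tendsto_sum_nat
  simp_rw [h3] at h4
  have h5 := h1.tendsto_sum_nat.add h2
  rw [add_zero] at h5
  exact tendsto_nhds_unique h4 h5

/-- The quantity is P(|X - X'| ≥ 2). Its positivity makes σ nonzero. -/
theorem skellam_gap_pos {l : ℝ} (hl : 0 < l) : 0 < 1 - skellamProb l 0 - 2 * skellamProb l 1 := by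
  have h : HasSum (fun k => 2 * poissonTail l (k + 2) * poissonProb l k)
      (1 - skellamProb l 0 - 2 * skellamProb l 1) := by
    refine ((hasSum_two_mul_poissonTail_mul hl.le).sub
      ((hasSum_skellamProb hl.le 1).mul_left 2)).congr_fun fun k => ?_
    rw [poissonTail_succ l (k + 1)]; ring
  have hp : ∀ k, 0 < 2 * poissonTail l (k + 2) * poissonProb l k := fun k =>
    mul_pos (mul_pos two_pos (poissonTail_pos hl _)) (poissonProb_pos hl _)
  rw [← h.tsum_eq]
  exact h.summable.tsum_pos (fun k => (hp k).le) 0 (hp 0)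

theorem hasDerivAt_poissonMin_div_sq {l : ℝ} (hl : 0 < l) :
    HasDerivAt (fun x => poissonMin x / x ^ 2)
      (-(1 - skellamProb l 0 - 2 * skellamProb l 1) / l ^ 2) l := by
  refine ((hasDerivAt_poissonMin hl).div (hasDerivAt_pow 2 l) (by positivity)).congr_deriv ?_
  rw [poissonMin_eq hl.le]
  field_simp
  simp
  ring

/-! ### Bessel functions and σ. -/

theorem summable_besselI (ν : ℕ) (x : ℝ) :
    Summable fun m : ℕ => (x / 2) ^ (2 * m + ν) / ((m ! : ℝ) * ((m + ν)! : ℝ)) := by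
  refine Summable.of_norm_bounded ((summable_pow_div_factorial ((|x| / 2) ^ 2)).mul_left
    ((|x| / 2) ^ ν)) fun m => ?_
  have h1 : (1 : ℝ) ≤ ((m + ν)! : ℝ) := by exact_mod_cast Nat.factorial_pos _
  rw [norm_div, norm_pow, norm_div, Real.norm_eq_abs, Real.norm_eq_abs, Real.norm_of_nonneg (by positivity)]
  rw [abs_two, pow_add, pow_mul, mul_comm, mul_div_assoc]
  refine mul_le_mul_of_nonneg_left ?_ (by positivity)
  rw [div_le_div_iff₀ (by positivity) (by positivity)]
  refine mul_le_mul_of_nonneg_left ?_ (by positivity)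
  nlinarith [show (0 : ℝ) < (m ! : ℝ) by positivity]

theorem continuous_besselI (ν : ℕ) : Continuous (besselI ν) := by
  refine continuous_iff_continuousAt.2 fun x => ?_
  have : ContinuousOn (besselI ν) (Set.Ioo (-(|x| + 1)) (|x| + 1)) := by
    refine continuousOn_tsum (fun m => by fun_prop) (summable_besselI ν (|x| + 1)) fun m y hy => ?_
    rw [norm_div, norm_pow, norm_div, Real.norm_eq_abs, Real.norm_eq_abs, 
      Real.norm_of_nonneg (by positivity), abs_two]
    have : |y| ≤ |x| + 1 := (abs_lt.2 hy).le
    gcongr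
  exact this.continuousAt (Ioo_mem_nhds (by linarith [neg_abs_le x]) (by linarith [le_abs_self x]))

theorem skellamProb_eq_besselI (l : ℝ) (d : ℕ) :
    skellamProb l d = Real.exp (-2 * l) * besselI d (2 * l) := by
  unfold skellamProb besselI
  rw [← tsum_mul_left]
  refine tsum_congr fun k => ?_
  unfold poissonProb
  rw [show -2 * l = -l + -l by ring, Real.exp_add, mul_div_cancel_left₀ l two_ne_zero]
  field_simp
  ring

/-- The recurrence I₀(x) - I₂(x) = (2/x) I₁(x) at x = 2l, cleared of the division. It reduces the
bracket in σ to I₀ + 2I₁. -/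
theorem mul_besselI_zero_sub_two (l : ℝ) :
    l * besselI 0 (2 * l) - l * besselI 2 (2 * l) = besselI 1 (2 * l) := by
  unfold besselI
  have h0 := (summable_besselI 0 (2 * l)).mul_left l
  have h1 := summable_besselI 1 (2 * l)
  rw [← tsum_mul_left, ← tsum_mul_left, h0.tsum_eq_zero_add, h1.tsum_eq_zero_add, add_sub_assoc,
    ← ((summable_nat_add_iff 1).2 h0).tsum_sub ((summable_besselI 2 (2 * l)).mul_left l)]
  congr 1
  · simp
  refine tsum_congr fun m => ?_
  rw [mul_div_cancel_left₀ l two_ne_zero]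
  simp only [Nat.factorial_succ, Nat.add_zero]
  push_cast
  field_simp
  ring

theorem exp_sub_one_sub_pos {l : ℝ} (hl : l ≠ 0) : 0 < Real.exp l - 1 - l := by
  have := Real.add_one_lt_exp hl
  linarith

theorem sigma_eq {l : ℝ} (hl : 0 < l) :
    sigma l = l * (1 - skellamProb l 0 - 2 * skellamProb l 1) / √(Real.exp l - 1 - l) := by
  have hk := skellam_gap_pos hl
  unfold sigma
  have : 1 - Real.exp (-2 * l) *
      ((1 + l) * besselI 0 (2 * l) + besselI 1 (2 * l) - l * besselI 2 (2 * l)) =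
      1 - skellamProb l 0 - 2 * skellamProb l 1 := by
    rw [skellamProb_eq_besselI, skellamProb_eq_besselI, ← mul_besselI_zero_sub_two]; ring
  rw [this, ← mul_pow, Real.sqrt_div (by positivity), Real.sqrt_sq (by positivity)]

theorem sigma_pos {l : ℝ} (hl : 0 < l) : 0 < sigma l := by
  rw [sigma_eq hl]
  exact div_pos (mul_pos hl (skellam_gap_pos hl)) (Real.sqrt_pos.2 (exp_sub_one_sub_pos hl.ne'))

theorem continuousAt_sigma {l : ℝ} (hl : 0 < l) : ContinuousAt sigma l := by
  unfold sigma
  have h := continuous_besselI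
  have h0 := h 0
  have h1 := h 1
  have h2 := h 2
  refine ContinuousAt.sqrt (ContinuousAt.div (by fun_prop) (by fun_prop)
    (exp_sub_one_sub_pos hl.ne').ne')

/-! ### The zero-inflated law and its expected maximum. -/

theorem prob_zero_eq (t p : ℝ) :
    prob t p 0 = 1 - (1 - p) * (1 - poissonProb (t / (1 - p)) 0) := by
  simp only [prob, poissonProb, neg_div, pow_zero, Nat.factorial_zero, Nat.cast_one]
  ring

theorem prob_eq_of_ne_zero (t : ℝ) {p : ℝ} (hp : p < 1) {k : ℕ} (hk : k ≠ 0) :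
    prob t p k = (1 - p) * poissonProb (t / (1 - p)) k := by
  obtain ⟨k, rfl⟩ := Nat.exists_eq_succ_of_ne_zero hk
  have : 1 - p ≠ 0 := by linarith
  simp only [Nat.succ_eq_add_one, prob, poissonProb, neg_div, div_pow]
  field_simp
  ring

theorem prob_nonneg {t p : ℝ} (h : IsParam t p) (k : ℕ) : 0 ≤ prob t p k := by
  rcases eq_or_ne k 0 with rfl | hk
  · exact h.2.2
  · rw [prob_eq_of_ne_zero t h.2.1 hk]
    have := h.2.1
    exact mul_nonneg (by linarith) (poissonProb_nonneg (div_nonneg h.1.le (by linarith)) k)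

theorem isParam_zero {t : ℝ} (ht : 0 < t) : IsParam t 0 :=
  ⟨ht, by norm_num, by simp only [prob]; simp; positivity⟩

theorem hasSum_prob {t p : ℝ} (hp : p < 1) : HasSum (prob t p) 1 := by
  have h := ((hasSum_poissonProb (t / (1 - p))).mul_left (1 - p)).update 0 (prob t p 0)
  rw [prob_zero_eq] at h
  have hf : Function.update (fun k => (1 - p) * poissonProb (t / (1 - p)) k) 0
      (1 - (1 - p) * (1 - poissonProb (t / (1 - p)) 0)) = prob t p := by
    funext k
    rcases eq_or_ne k 0 with rfl | hk
    · simp [prob_zero_eq]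
    · simp [hk, prob_eq_of_ne_zero t hp hk]
  rw [hf] at h
  convert! h using 1
  ring

theorem law_singleton (t p : ℝ) (k : ℕ) : law t p {k} = ENNReal.ofReal (prob t p k) := by
  rw [law, Measure.sum_apply _ (measurableSet_singleton k), tsum_eq_single k]
  · simp
  · intro j hj; simp [hj]

theorem lintegral_law (t p : ℝ) (f : ℕ → ENNReal) :
    ∫⁻ k, f k ∂(law t p) = ∑' k, ENNReal.ofReal (prob t p k) * f k := by
  rw [law, lintegral_sum_measure]
  simp

theorem isProbabilityMeasure_law {t p : ℝ} (h : IsParam t p) : IsProbabilityMeasure (law t p) := by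
  refine ⟨?_⟩
  rw [← lintegral_one, lintegral_law]
  simp only [mul_one]
  rw [← ENNReal.ofReal_tsum_of_nonneg (prob_nonneg h) (hasSum_prob h.2.1).summable,
    (hasSum_prob h.2.1).tsum_eq, ENNReal.ofReal_one]

/-- Tails beyond 0 do not see the extra mass at 0, so they are Poisson tails scaled by 1 - p, also
for negative p. -/
theorem law_Ici_succ {t p : ℝ} (h : IsParam t p) (k : ℕ) :
    law t p (Set.Ici (k + 1)) =
      ENNReal.ofReal ((1 - p) * poissonTail (t / (1 - p)) (k + 1)) := by
  have := isProbabilityMeasure_law h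
  have hc : Set.Ici (k + 1) = (↑(Finset.range (k + 1)) : Set ℕ)ᶜ := by
    ext i; simp
  rw [hc, prob_compl_eq_one_sub (Finset.measurableSet _), ← sum_measure_singleton]
  simp_rw [law_singleton]
  rw [← ENNReal.ofReal_sum_of_nonneg fun i _ => prob_nonneg h i, ← ENNReal.ofReal_one,
    ← ENNReal.ofReal_sub _ (Finset.sum_nonneg fun i _ => prob_nonneg h i)]
  congr 1
  unfold poissonTail
  rw [Finset.sum_range_succ', Finset.sum_range_succ', prob_zero_eq]
  simp_rw [prob_eq_of_ne_zero t h.2.1 (Nat.succ_ne_zero _)]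
  rw [← Finset.mul_sum]
  ring

theorem hasSum_prob_mul_id {t p : ℝ} (hp : p < 1) : HasSum (fun k => prob t p k * (k : ℝ)) t := by
  have hw : 1 - p ≠ 0 := by linarith
  rw [← hasSum_nat_add_iff' 1]
  simp only [Finset.range_one, Finset.sum_singleton, Nat.cast_zero, mul_zero, sub_zero]
  have h := (hasSum_poissonProb (t / (1 - p))).mul_left t
  rw [mul_one] at h
  refine h.congr_fun fun k => ?_
  rw [prob_eq_of_ne_zero t hp (Nat.succ_ne_zero k)]
  have := succ_mul_poissonProb_succ (t / (1 - p)) k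
  push_cast
  rw [mul_assoc, mul_comm (poissonProb _ _), this]
  field_simp

theorem lintegral_id_law {t p : ℝ} (h : IsParam t p) :
    ∫⁻ k, (k : ENNReal) ∂(law t p) = ENNReal.ofReal t := by
  rw [lintegral_law]
  have : ∀ k : ℕ, ENNReal.ofReal (prob t p k) * (k : ENNReal) =
      ENNReal.ofReal (prob t p k * (k : ℝ)) := fun k => by
    rw [ENNReal.ofReal_mul (prob_nonneg h k), ENNReal.ofReal_natCast]
  simp_rw [this]
  rw [← ENNReal.ofReal_tsum_of_nonneg (fun k => mul_nonneg (prob_nonneg h k) k.cast_nonneg)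
    (hasSum_prob_mul_id h.2.1).summable, (hasSum_prob_mul_id h.2.1).tsum_eq]

theorem tsum_indicator_lt (n : ℕ) :
    ∑' k : ℕ, (Set.Ici (k + 1)).indicator (1 : ℕ → ENNReal) n = n := by
  rw [tsum_eq_sum (s := Finset.range n)]
  · rw [Finset.sum_congr rfl (g := fun _ => 1)]
    · simp
    · intro k hk
      have := Finset.mem_range.1 hk
      simp [Set.indicator]; omega
  · intro k hk
    have := Finset.mem_range.not.1 hk
    simp [Set.indicator]; omega

/-- Layer-cake formula; by independence the minimum exceeds k with the squared tail probability. -/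
theorem lintegral_min_law {t p : ℝ} (h : IsParam t p) :
    ∫⁻ y : ℕ × ℕ, ((min y.1 y.2 : ℕ) : ENNReal) ∂((law t p).prod (law t p)) =
      ENNReal.ofReal ((1 - p) ^ 2 * poissonMin (t / (1 - p))) := by
  have := isProbabilityMeasure_law h
  have hl : 0 ≤ t / (1 - p) := div_nonneg h.1.le (by linarith [h.2.1])
  simp_rw [← tsum_indicator_lt (min _ _)]
  rw [lintegral_tsum fun k => by fun_prop]
  have hk : ∀ k : ℕ, ∫⁻ y : ℕ × ℕ, (Set.Ici (k + 1)).indicator (1 : ℕ → ENNReal) (min y.1 y.2)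
      ∂((law t p).prod (law t p)) =
      ENNReal.ofReal ((1 - p) ^ 2 * poissonTail (t / (1 - p)) (k + 1) ^ 2) := fun k => by
    have : (fun y : ℕ × ℕ => (Set.Ici (k + 1)).indicator (1 : ℕ → ENNReal) (min y.1 y.2)) =
        (Set.Ici (k + 1) ×ˢ Set.Ici (k + 1)).indicator 1 := by
      funext y; simp [Set.indicator, Prod.le_def]
    rw [this, lintegral_indicator_one (by measurability), Measure.prod_prod, law_Ici_succ h,
      ← ENNReal.ofReal_mul (mul_nonneg (by linarith [h.2.1]) (poissonTail_nonneg hl _))]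
    congr 1; ring
  simp_rw [hk]
  rw [← ENNReal.ofReal_tsum_of_nonneg (fun k => by positivity)
    ((summable_poissonTail_sq hl).mul_left _), tsum_mul_left, poissonMin]

/-- Integrate max + min = sum. Working in `ENNReal` first yields finiteness of the expected maximum
as a by-product. -/
theorem expMax2_eq {t p : ℝ} (h : IsParam t p) :
    expMax2 t p = 2 * t - (1 - p) ^ 2 * poissonMin (t / (1 - p)) := by
  have := isProbabilityMeasure_law h
  have hb : 0 ≤ (1 - p) ^ 2 * poissonMin (t / (1 - p)) :=
    mul_nonneg (sq_nonneg _) (tsum_nonneg fun _ => sq_nonneg _)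
  have hadd : ∫⁻ y : ℕ × ℕ, ((max y.1 y.2 : ℕ) : ENNReal) ∂((law t p).prod (law t p)) +
      ENNReal.ofReal ((1 - p) ^ 2 * poissonMin (t / (1 - p))) = ENNReal.ofReal (2 * t) := by
    rw [← lintegral_min_law h, ← lintegral_add_left (by fun_prop)]
    have : ∀ y : ℕ × ℕ, ((max y.1 y.2 : ℕ) : ENNReal) + ((min y.1 y.2 : ℕ) : ENNReal) =
        (y.1 : ENNReal) + (y.2 : ENNReal) := fun y => by
      exact_mod_cast congrArg (Nat.cast (R := ENNReal)) (max_add_min y.1 y.2)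
    simp_rw [this]
    rw [lintegral_add_left (by fun_prop), lintegral_prod _ (by fun_prop),
      lintegral_prod _ (by fun_prop)]
    simp only [lintegral_const, measure_univ, mul_one, lintegral_id_law h]
    rw [← ENNReal.ofReal_add h.1.le h.1.le, two_mul]
  unfold expMax2
  have hint := integral_toReal (μ := (law t p).prod (law t p))
    (f := fun y : ℕ × ℕ => ((max y.1 y.2 : ℕ) : ENNReal)) (by fun_prop)
    (Eventually.of_forall fun y => ENNReal.natCast_lt_top _)
  simp only [ENNReal.toReal_natCast] at hint
  rw [hint]
  have hfin : ∫⁻ y : ℕ × ℕ, ((max y.1 y.2 : ℕ) : ENNReal) ∂((law t p).prod (law t p)) ≠ ⊤ := by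
    intro htop
    rw [htop, top_add] at hadd
    exact ENNReal.ofReal_ne_top hadd.symm
  have h2 := congrArg ENNReal.toReal hadd
  rw [ENNReal.toReal_add hfin ENNReal.ofReal_ne_top, ENNReal.toReal_ofReal hb,
    ENNReal.toReal_ofReal (by linarith [h.1])] at h2
  linarith

theorem discrepancy_eq {t p : ℝ} (h : IsParam t p) :
    discrepancy t p = t ^ 2 * (poissonMin t / t ^ 2 -
      poissonMin (t / (1 - p)) / (t / (1 - p)) ^ 2) := by
  have ht := h.1
  have hw : 0 < 1 - p := by linarith [h.2.1]
  rw [discrepancy, expMax2_eq h, expMax2_eq (isParam_zero ht)]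
  simp only [sub_zero, div_one]
  field_simp
  ring

/-! ### The maximum likelihood estimate. -/

/-- The mean of a Poisson variable with parameter `l` conditioned on being positive. -/
def truncMean (l : ℝ) : ℝ := l / (1 - Real.exp (-l))

theorem one_sub_exp_neg_pos {l : ℝ} (hl : 0 < l) : 0 < 1 - Real.exp (-l) :=
  sub_pos.2 (Real.exp_lt_one_iff.2 (by linarith))

theorem hasStrictDerivAt_truncMean {l : ℝ} (hl : 0 < l) :
    HasStrictDerivAt truncMean
      ((1 - Real.exp (-l) - l * Real.exp (-l)) / (1 - Real.exp (-l)) ^ 2) l := by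
  refine ((hasStrictDerivAt_id l).div
    (((hasStrictDerivAt_id l).neg.exp).const_sub 1) (one_sub_exp_neg_pos hl).ne').congr_deriv ?_
  simp

theorem truncMean_deriv_numerator_pos {l : ℝ} (hl : 0 < l) :
    0 < 1 - Real.exp (-l) - l * Real.exp (-l) := by
  have h := exp_sub_one_sub_pos hl.ne'
  have : 1 - Real.exp (-l) - l * Real.exp (-l) = Real.exp (-l) * (Real.exp l - 1 - l) := by
    have : Real.exp (-l) * Real.exp l = 1 := by rw [← Real.exp_add]; simp
    linear_combination -this
  rw [this]
  positivity

theorem truncMean_strictMonoOn : StrictMonoOn truncMean (Set.Ioi 0) := by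
  refine strictMonoOn_of_deriv_pos (convex_Ioi 0)
    (fun x hx => (hasStrictDerivAt_truncMean hx).hasDerivAt.continuousAt.continuousWithinAt)
    fun x hx => ?_
  rw [interior_Ioi] at hx
  rw [(hasStrictDerivAt_truncMean hx).hasDerivAt.deriv]
  exact div_pos (truncMean_deriv_numerator_pos hx) (pow_pos (one_sub_exp_neg_pos hx) 2)

/-- The log-likelihood of the parameter of a zero-truncated Poisson law for `m` observations with
sum `S`, up to an additive constant. -/
def truncLogLik (m S l : ℝ) : ℝ := S * Real.log l - m * Real.log (Real.exp l - 1)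

/-- In this form, for m > 0, the sign of the derivative can be read off from the monotonicity of
`truncMean`. -/
theorem hasDerivAt_truncLogLik {m S l l₀ : ℝ} (hm : m ≠ 0) (hl : 0 < l)
    (h : truncMean l₀ = S / m) :
    HasDerivAt (truncLogLik m S) (m / l * (truncMean l₀ - truncMean l)) l := by
  have he : 0 < Real.exp l - 1 := by linarith [Real.add_one_lt_exp hl.ne']
  refine (((Real.hasDerivAt_log hl.ne').const_mul S).sub
    ((((Real.hasDerivAt_exp l).sub_const 1).log he.ne').const_mul m)).congr_deriv ?_
  rw [h, truncMean, Real.exp_neg]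
  have : Real.exp l ≠ 0 := (Real.exp_pos l).ne'
  have h2 : 1 - (Real.exp l)⁻¹ ≠ 0 := by
    rw [← Real.exp_neg]; exact (one_sub_exp_neg_pos hl).ne'
  have h3 : 1 - (Real.exp l)⁻¹ = (Real.exp l - 1) / Real.exp l := by field_simp
  rw [h3]
  field_simp

theorem truncLogLik_lt {m S l l₀ : ℝ} (hm : 0 < m) (hl : 0 < l) (hl₀ : 0 < l₀)
    (h : truncMean l₀ = S / m) (hne : l ≠ l₀) : truncLogLik m S l < truncLogLik m S l₀ := by
  rcases lt_or_gt_of_ne hne with hlt | hlt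
  · have : StrictMonoOn (truncLogLik m S) (Set.Icc l l₀) := by
      refine strictMonoOn_of_deriv_pos (convex_Icc _ _) (fun x hx =>
        (hasDerivAt_truncLogLik hm.ne' (hl.trans_le hx.1) h).continuousAt.continuousWithinAt)
        fun x hx => ?_
      rw [interior_Icc] at hx
      have hx0 := hl.trans hx.1
      rw [(hasDerivAt_truncLogLik hm.ne' hx0 h).deriv]
      exact mul_pos (div_pos hm hx0) (sub_pos.2 (truncMean_strictMonoOn hx0 hl₀ hx.2))
    exact this (Set.left_mem_Icc.2 hlt.le) (Set.right_mem_Icc.2 hlt.le) hlt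
  · have : StrictAntiOn (truncLogLik m S) (Set.Icc l₀ l) := by
      refine strictAntiOn_of_deriv_neg (convex_Icc _ _) (fun x hx =>
        (hasDerivAt_truncLogLik hm.ne' (hl₀.trans_le hx.1) h).continuousAt.continuousWithinAt)
        fun x hx => ?_
      rw [interior_Icc] at hx
      have hx0 := hl₀.trans hx.1
      rw [(hasDerivAt_truncLogLik hm.ne' hx0 h).deriv]
      exact mul_neg_of_pos_of_neg (div_pos hm hx0)
        (sub_neg.2 (truncMean_strictMonoOn hl₀ hx0 hx.1))
    exact this (Set.left_mem_Icc.2 hlt.le) (Set.right_mem_Icc.2 hlt.le) hlt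

/-- Gibbs' inequality: apply log x ≤ x - 1 to both likelihood ratios; the weighted bounds sum to
zero. -/
theorem bernoulliLogLik_lt {a b q : ℝ} (ha : 0 < a) (hb : 0 < b) (hq : 0 < q) (hq1 : q < 1)
    (hne : q ≠ a / (a + b)) :
    a * Real.log q + b * Real.log (1 - q) <
      a * Real.log (a / (a + b)) + b * Real.log (1 - a / (a + b)) := by
  have hab : 0 < a + b := by linarith
  have hc : 1 - a / (a + b) = b / (a + b) := by field_simp; ring
  rw [hc]
  have h1 : Real.log q - Real.log (a / (a + b)) < q / (a / (a + b)) - 1 := by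
    rw [← Real.log_div hq.ne' (by positivity)]
    refine Real.log_lt_sub_one_of_pos (by positivity) fun h => hne ?_
    rwa [div_eq_one_iff_eq (by positivity)] at h
  have h2 : Real.log (1 - q) - Real.log (b / (a + b)) ≤ (1 - q) / (b / (a + b)) - 1 := by
    have h0 : 0 < 1 - q := by linarith
    rw [← Real.log_div h0.ne' (by positivity)]
    exact Real.log_le_sub_one_of_pos (by positivity)
  have h3 : a * (q / (a / (a + b)) - 1) + b * ((1 - q) / (b / (a + b)) - 1) = 0 := by
    field_simp; ring
  nlinarith [mul_lt_mul_of_pos_left h1 ha, mul_le_mul_of_nonneg_left h2 hb.le]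

theorem one_sub_prob_zero (t p : ℝ) :
    1 - prob t p 0 = (1 - p) * (1 - Real.exp (-(t / (1 - p)))) := by
  rw [prob_zero_eq]; simp [poissonProb]

theorem prob_zero_lt_one {t p : ℝ} (h : IsParam t p) : prob t p 0 < 1 := by
  have hw : 0 < 1 - p := by linarith [h.2.1]
  have := mul_pos hw (one_sub_exp_neg_pos (div_pos h.1 hw))
  rw [← one_sub_prob_zero] at this
  linarith

theorem prob_eq_ite {t p : ℝ} (h : IsParam t p) (k : ℕ) :
    prob t p k = (if k = 0 then prob t p 0 else
      (1 - prob t p 0) / (Real.exp (t / (1 - p)) - 1)) * ((t / (1 - p)) ^ k / (k ! : ℝ)) := by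
  split_ifs with hk
  · subst hk; simp
  · have hw : 0 < 1 - p := by linarith [h.2.1]
    have hl := div_pos h.1 hw
    have he : Real.exp (t / (1 - p)) - 1 ≠ 0 := by linarith [Real.add_one_lt_exp hl.ne']
    rw [prob_eq_of_ne_zero t h.2.1 hk, one_sub_prob_zero, poissonProb, Real.exp_neg]
    have := (Real.exp_pos (t / (1 - p))).ne'
    field_simp

theorem likelihood_eq {n : ℕ} (y : Fin n → ℕ) {t p : ℝ} (h : IsParam t p) :
    likelihood y t p = prob t p 0 ^ (Finset.univ.filter fun i => y i = 0).card *
      ((1 - prob t p 0) / (Real.exp (t / (1 - p)) - 1)) ^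
        (Finset.univ.filter fun i => ¬ y i = 0).card *
      (t / (1 - p)) ^ (∑ i, y i) * ∏ i, ((y i)! : ℝ)⁻¹ := by
  unfold likelihood
  simp_rw [prob_eq_ite h (y _), div_eq_mul_inv ((t / (1 - p)) ^ _)]
  rw [Finset.prod_mul_distrib, Finset.prod_mul_distrib, Finset.prod_ite, Finset.prod_const,
    Finset.prod_const, Finset.prod_pow_eq_pow_sum]
  ring

theorem likelihood_eq_exp {n : ℕ} (y : Fin n → ℕ) {t p : ℝ} (h : IsParam t p)
    (hq : 0 < prob t p 0) :
    likelihood y t p = Real.exp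
      (((Finset.univ.filter fun i => y i = 0).card * Real.log (prob t p 0) +
        (Finset.univ.filter fun i => ¬ y i = 0).card * Real.log (1 - prob t p 0)) +
        truncLogLik (Finset.univ.filter fun i => ¬ y i = 0).card (∑ i, y i : ℕ) (t / (1 - p))) *
      ∏ i, ((y i)! : ℝ)⁻¹ := by
  have hw : 0 < 1 - p := by linarith [h.2.1]
  have hl := div_pos h.1 hw
  have he : 0 < Real.exp (t / (1 - p)) - 1 := by linarith [Real.add_one_lt_exp hl.ne']
  have hq1 : 0 < 1 - prob t p 0 := by linarith [prob_zero_lt_one h]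
  rw [likelihood_eq y h]
  congr 1
  have hpos : 0 < prob t p 0 ^ (Finset.univ.filter fun i => y i = 0).card *
      ((1 - prob t p 0) / (Real.exp (t / (1 - p)) - 1)) ^
        (Finset.univ.filter fun i => ¬ y i = 0).card *
      (t / (1 - p)) ^ (∑ i, y i) := by positivity
  rw [← Real.exp_log hpos, Real.log_mul (by positivity) (by positivity),
    Real.log_mul (by positivity) (by positivity), Real.log_pow, Real.log_pow, Real.log_pow,
    Real.log_div hq1.ne' he.ne', truncLogLik]
  congr 1
  ring

/-- The coordinates q and λ vary independently, with 1 - p = (1-q)/(1-e^{-λ}). Admitting negative p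
is what makes every q in [0,1) available, so the two factors can be maximized separately. -/
theorem exists_isParam_of_prob_zero {q l : ℝ} (hq : 0 ≤ q) (hq1 : q < 1) (hl : 0 < l) :
    ∃ t p, IsParam t p ∧ prob t p 0 = q ∧ t / (1 - p) = l := by
  have he := one_sub_exp_neg_pos hl
  have hw : 0 < (1 - q) / (1 - Real.exp (-l)) := div_pos (by linarith) he
  have hd : (1 - q) / (1 - Real.exp (-l)) * l / (1 - (1 - (1 - q) / (1 - Real.exp (-l)))) = l := by
    rw [sub_sub_cancel, mul_div_cancel_left₀ _ hw.ne']
  have hp : prob ((1 - q) / (1 - Real.exp (-l)) * l) (1 - (1 - q) / (1 - Real.exp (-l))) 0 = q := by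
    have := one_sub_prob_zero ((1 - q) / (1 - Real.exp (-l)) * l)
      (1 - (1 - q) / (1 - Real.exp (-l)))
    rw [hd, sub_sub_cancel, div_mul_cancel₀ _ he.ne'] at this
    linarith
  exact ⟨_, _, ⟨mul_pos hw hl, by linarith, by rw [hp]; exact hq⟩, hp, hd⟩

theorem mle_exists_and_eq {n : ℕ} (y : Fin n → ℕ) {l₀ : ℝ}
    (h0 : (Finset.univ.filter fun i => y i = 0).card ≠ 0)
    (h1 : (Finset.univ.filter fun i => ¬ y i = 0).card ≠ 0) (hl₀ : 0 < l₀)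
    (h : truncMean l₀ = (∑ i, y i : ℕ) / (Finset.univ.filter fun i => ¬ y i = 0).card) :
    (∃ t p, IsMLE y t p) ∧
      ∀ t p, IsMLE y t p → t = (∑ i, y i : ℕ) / (n : ℝ) ∧ t / (1 - p) = l₀ := by
  have hn : ((Finset.univ.filter fun i => y i = 0).card : ℝ) +
      (Finset.univ.filter fun i => ¬ y i = 0).card = n := by
    exact_mod_cast (Finset.card_filter_add_card_filter_not (s := (Finset.univ : Finset (Fin n)))
      (fun i => y i = 0)).trans (by simp)
  have ha : (0 : ℝ) < (Finset.univ.filter fun i => y i = 0).card := by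
    exact_mod_cast Nat.pos_of_ne_zero h0
  have hb : (0 : ℝ) < (Finset.univ.filter fun i => ¬ y i = 0).card := by
    exact_mod_cast Nat.pos_of_ne_zero h1
  have hc : 0 < ∏ i, ((y i)! : ℝ)⁻¹ := Finset.prod_pos fun i _ => by positivity
  have hnpos : (0 : ℝ) < n := by linarith
  have hq0 : 0 < ((Finset.univ.filter fun i => y i = 0).card : ℝ) / n := by positivity
  have hq1 : ((Finset.univ.filter fun i => y i = 0).card : ℝ) / n < 1 := by
    rw [div_lt_one hnpos]; linarith
  obtain ⟨t₀, p₀, hpar, hprob, hlam⟩ := exists_isParam_of_prob_zero hq0.le hq1 hl₀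
  -- Any parameter doing at least as well as the candidate shares its coordinates; this gives both
  -- existence and uniqueness.
  have key : ∀ t p, IsParam t p → likelihood y t₀ p₀ ≤ likelihood y t p →
      prob t p 0 = ((Finset.univ.filter fun i => y i = 0).card : ℝ) / n ∧ t / (1 - p) = l₀ := by
    intro t p hp hle
    have hw : 0 < 1 - p := by linarith [hp.2.1]
    have hpos : 0 < prob t p 0 := by
      -- A zero was observed, so mass 0 at zero would make the likelihood vanish.
      refine lt_of_le_of_ne hp.2.2 fun h2 => ?_
      rw [likelihood_eq y hp, ← h2, zero_pow h0, zero_mul, zero_mul, zero_mul,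
        likelihood_eq_exp y hpar (hprob ▸ hq0)] at hle
      exact absurd hle (not_le.2 (by positivity))
    rw [likelihood_eq_exp y hp hpos, likelihood_eq_exp y hpar (hprob ▸ hq0),
      mul_le_mul_iff_left₀ hc, Real.exp_le_exp, hprob, hlam] at hle
    have hB := bernoulliLogLik_lt ha hb hpos (prob_zero_lt_one hp)
    have hT := truncLogLik_lt hb (div_pos hp.1 hw) hl₀ h
    rw [hn] at hB
    by_cases e1 : prob t p 0 = ((Finset.univ.filter fun i => y i = 0).card : ℝ) / n
    · refine ⟨e1, ?_⟩
      by_contra e2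
      have := hT e2
      rw [e1] at hle
      linarith
    · have hB' := hB e1
      by_cases e2 : t / (1 - p) = l₀
      · rw [e2] at hle; linarith
      · have := hT e2; linarith
  refine ⟨⟨t₀, p₀, hpar, fun t p hp => ?_⟩, fun t p hM => ?_⟩
  · by_contra hlt
    rw [not_le] at hlt
    obtain ⟨e1, e2⟩ := key t p hp hlt.le
    rw [likelihood_eq y hp, likelihood_eq y hpar, e1, e2, hprob, hlam] at hlt
    exact lt_irrefl _ hlt
  · obtain ⟨e1, e2⟩ := key t p hM.1 (hM.2 t₀ p₀ hpar)
    refine ⟨?_, e2⟩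
    have hw : 1 - p ≠ 0 := by linarith [hM.1.2.1]
    have h3 := one_sub_prob_zero t p
    have he := (one_sub_exp_neg_pos hl₀).ne'
    rw [e1, e2] at h3
    rw [truncMean, div_eq_div_iff he hb.ne'] at h
    rw [div_eq_iff hw] at e2
    have h4 : ((Finset.univ.filter fun i => ¬ y i = 0).card : ℝ) / n =
        (1 - p) * (1 - Real.exp (-l₀)) := by
      rw [← h3, ← hn]; field_simp; ring
    rw [div_eq_iff hnpos.ne'] at h4
    rw [e2, eq_div_iff hnpos.ne']
    have h5 : l₀ * (1 - p) * n * (1 - Real.exp (-l₀)) =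
        ((∑ i, y i : ℕ) : ℝ) * (1 - Real.exp (-l₀)) := by
      rw [← h, h4]; ring
    exact mul_right_cancel₀ he h5

/-! ### Delta method and Chebyshev's inequality. -/

/-- The first order delta method: if `√n • (U n - x₀)` is bounded in probability and `T n` is given
by `√n * f (U n)` near `x₀`, where `f x₀ = 0`, then `T n` may be replaced by its linearization. -/
theorem tendstoInMeasure_sub_linearization {Ω E : Type*} [MeasurableSpace Ω] {P : Measure Ω}
    [IsProbabilityMeasure P] [NormedAddCommGroup E] [NormedSpace ℝ E] {U : ℕ → Ω → E} {x₀ : E}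
    {K : ℝ} (hU : ∀ n : ℕ, ∀ c > 0, P.real {ω | c ≤ √n * ‖U n ω - x₀‖} ≤ K / c ^ 2)
    {f : E → ℝ} {L : E →L[ℝ] ℝ} (hf : HasFDerivAt f L x₀) (hf0 : f x₀ = 0) {T : ℕ → Ω → ℝ}
    (hT : ∀ᶠ x in nhds x₀, ∀ (n : ℕ) ω, U n ω = x → T n ω = √n * f x) :
    TendstoInMeasure P (fun (n : ℕ) ω => T n ω - √n * L (U n ω - x₀)) atTop 0 := by
  rw [tendstoInMeasure_iff_measureReal_norm]
  intro ε hε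
  have hK : 0 ≤ K := by
    have := (measureReal_nonneg).trans (hU 0 1 one_pos)
    simpa using this
  refine tendsto_order.2 ⟨fun a ha => Eventually.of_forall fun n =>
    ha.trans_le measureReal_nonneg, fun η hη => ?_⟩
  -- The slope c allowed in the linearization error is small enough that `hU` at level ε/c costs
  -- less than η/2.
  obtain ⟨c, hc, hcη⟩ : ∃ c > 0, K * c ^ 2 / ε ^ 2 < η / 2 := by
    have : Tendsto (fun c : ℝ => K * c ^ 2 / ε ^ 2) (nhdsWithin 0 (Set.Ioi 0)) (nhds 0) := by
      have h : ContinuousAt (fun c : ℝ => K * c ^ 2 / ε ^ 2) 0 := by fun_prop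
      have := h.tendsto
      simp only [ne_eq, OfNat.ofNat_ne_zero, not_false_eq_true, zero_pow, mul_zero, zero_div] at this
      exact this.mono_left nhdsWithin_le_nhds
    obtain ⟨c, h1, h2⟩ := ((this.eventually_lt_const (half_pos hη)).and self_mem_nhdsWithin).exists
    exact ⟨c, h2, h1⟩
  have hlin := (hasFDerivAt_iff_isLittleO.1 hf).bound hc
  obtain ⟨δ, hδ, hball⟩ := Metric.eventually_nhds_iff.1 (hlin.and hT)
  have hlim : Tendsto (fun n : ℕ => K / δ ^ 2 / (n : ℝ)) atTop (nhds 0) :=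
    tendsto_const_div_atTop_nhds_zero_nat _
  filter_upwards [hlim.eventually_lt_const (half_pos hη), eventually_gt_atTop 0] with n hn hn0
  have hnpos : (0 : ℝ) < n := by exact_mod_cast hn0
  -- Either U n leaves the ball where `T` is controlled, or the error is at most c √n ‖U n - x₀‖.
  have hsub : {ω | ε ≤ ‖T n ω - √n * L (U n ω - x₀) - (0 : Ω → ℝ) ω‖} ⊆
      {ω | √n * δ ≤ √n * ‖U n ω - x₀‖} ∪ {ω | ε / c ≤ √n * ‖U n ω - x₀‖} := by
    intro ω hω
    by_cases h : δ ≤ ‖U n ω - x₀‖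
    · left; exact mul_le_mul_of_nonneg_left h (Real.sqrt_nonneg _)
    · right
      rw [not_le, ← dist_eq_norm] at h
      obtain ⟨h1, h2⟩ := hball h
      rw [hf0, sub_zero] at h1
      have h3 : ε ≤ ‖T n ω - √n * L (U n ω - x₀) - (0 : Ω → ℝ) ω‖ := hω
      rw [Pi.zero_apply, sub_zero, h2 n ω rfl, ← mul_sub, norm_mul,
        Real.norm_of_nonneg (Real.sqrt_nonneg _)] at h3
      have h4 := mul_le_mul_of_nonneg_left h1 (Real.sqrt_nonneg (n : ℝ))
      change ε / c ≤ √n * ‖U n ω - x₀‖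
      rw [div_le_iff₀ hc]
      linarith
  refine (measureReal_mono (μ := P) hsub).trans_lt ((measureReal_union_le _ _).trans_lt ?_)
  have h1 := hU n (√n * δ) (by positivity)
  have h2 := hU n (ε / c) (by positivity)
  rw [mul_pow, Real.sq_sqrt hnpos.le, mul_comm (n : ℝ), ← div_div] at h1
  have h3 : K / (ε / c) ^ 2 = K * c ^ 2 / ε ^ 2 := by field_simp
  rw [h3] at h2
  linarith

/-- Chebyshev's inequality for the standardized mean of an i.i.d. sequence. -/
theorem measureReal_sqrt_mul_abs_mean_sub_le {Ω : Type*} [MeasurableSpace Ω] {P : Measure Ω}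
    [IsProbabilityMeasure P] {X : ℕ → Ω → ℝ} (hX : MemLp (X 0) 2 P) (hindep : iIndepFun X P)
    (hident : ∀ i, IdentDistrib (X i) (X 0) P P) (n : ℕ) {c : ℝ} (hc : 0 < c) :
    P.real {ω | c ≤ √n * |(∑ i ∈ Finset.range n, X i ω) / n - P[X 0]|} ≤ Var[X 0; P] / c ^ 2 := by
  have hv : 0 ≤ Var[X 0; P] / c ^ 2 := div_nonneg (variance_nonneg _ _) (sq_nonneg _)
  rcases Nat.eq_zero_or_pos n with rfl | hn
  · simp [not_le.2 hc, hv]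
  have hnpos : (0 : ℝ) < n := by exact_mod_cast hn
  have hLp : ∀ i, MemLp (X i) 2 P := fun i => (hident i).memLp_iff.2 hX
  have hvar : Var[∑ i ∈ Finset.range n, X i; P] = n * Var[X 0; P] := by
    rw [IndepFun.variance_sum (fun i _ => hLp i) fun i _ j _ hij => hindep.indepFun hij]
    simp [(hident _).variance_eq]
  have hmean : P[∑ i ∈ Finset.range n, X i] = (n : ℝ) * P[X 0] := by
    simp only [Finset.sum_apply]
    rw [integral_finsetSum _ fun i _ => (hLp i).integrable (by norm_num)]
    simp [(hident _).integral_eq]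
  have h := meas_ge_le_variance_div_sq (memLp_finsetSum' (Finset.range n) fun i _ => hLp i)
    (c := √n * c) (by positivity)
  rw [hvar, hmean, mul_pow, Real.sq_sqrt hnpos.le, mul_div_mul_left _ _ hnpos.ne'] at h
  have hset : {ω | c ≤ √n * |(∑ i ∈ Finset.range n, X i ω) / n - P[X 0]|} =
      {ω | √n * c ≤ |(∑ i ∈ Finset.range n, X i) ω - n * P[X 0]|} := by
    ext ω
    simp only [Set.mem_ofPred_eq, Finset.sum_apply]
    have h1 : (∑ i ∈ Finset.range n, X i ω) - n * P[X 0] =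
        √n * (√n * ((∑ i ∈ Finset.range n, X i ω) / n - P[X 0])) := by
      rw [← mul_assoc, Real.mul_self_sqrt hnpos.le]; field_simp
    rw [h1, abs_mul, abs_mul, abs_of_nonneg (Real.sqrt_nonneg _)]
    exact (mul_le_mul_iff_right₀ (Real.sqrt_pos.2 hnpos)).symm
  rw [hset, measureReal_def]
  exact ENNReal.toReal_le_of_le_ofReal hv h

/-! ### Moments under the null hypothesis. -/

theorem prob_param_zero (t : ℝ) (k : ℕ) : prob t 0 k = poissonProb t k := by
  rcases eq_or_ne k 0 with rfl | hk
  · simp [prob_zero_eq]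
  · simp [prob_eq_of_ne_zero t zero_lt_one hk]

theorem integrable_law_zero {t : ℝ} (ht : 0 < t) {f : ℕ → ℝ}
    (hf : Summable fun k => poissonProb t k * |f k|) : Integrable f (law t 0) := by
  rw [law, integrable_sum_dirac_iff (by simp)]
  refine hf.congr fun k => ?_
  rw [prob_param_zero, ENNReal.toReal_ofReal (poissonProb_nonneg ht.le k), Real.norm_eq_abs]

theorem integral_law_zero {t : ℝ} (ht : 0 < t) {f : ℕ → ℝ} {c : ℝ}
    (hf : HasSum (fun k => poissonProb t k * f k) c) : ∫ k, f k ∂(law t 0) = c := by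
  rw [law, integral_sum_dirac (by simp), ← hf.tsum_eq]
  refine tsum_congr fun k => ?_
  rw [prob_param_zero, ENNReal.toReal_ofReal (poissonProb_nonneg ht.le k), smul_eq_mul]

theorem hasSum_poissonProb_mul_id (t : ℝ) : HasSum (fun k => poissonProb t k * (k : ℝ)) t := by
  simpa [prob_param_zero] using hasSum_prob_mul_id (t := t) zero_lt_one

theorem hasSum_poissonProb_mul_sq (t : ℝ) :
    HasSum (fun k => poissonProb t k * (k : ℝ) ^ 2) (t * (t + 1)) := by
  rw [← hasSum_nat_add_iff' 1]
  simp only [Finset.range_one, Finset.sum_singleton, Nat.cast_zero, ne_eq, OfNat.ofNat_ne_zero,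
    not_false_eq_true, zero_pow, mul_zero, sub_zero]
  refine (((hasSum_poissonProb_mul_id t).add (hasSum_poissonProb t)).mul_left t).congr_fun
    fun k => ?_
  have := succ_mul_poissonProb_succ t k
  push_cast
  linear_combination ((k : ℝ) + 1) * this

theorem hasSum_poissonProb_mul_indicator (t : ℝ) :
    HasSum (fun k => poissonProb t k * (if k = 0 then 0 else 1)) (1 - Real.exp (-t)) := by
  have h := (hasSum_poissonProb t).update 0 0
  convert! h using 1
  · funext k
    rcases eq_or_ne k 0 with rfl | hk
    · simp
    · simp [hk]
  · simp [poissonProb]; ring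

theorem memLp_two_law_zero {t : ℝ} (ht : 0 < t) {f : ℕ → ℝ} {c : ℝ}
    (hf : HasSum (fun k => poissonProb t k * f k ^ 2) c) : MemLp f 2 (law t 0) := by
  rw [memLp_two_iff_integrable_sq (by fun_prop)]
  refine integrable_law_zero ht ?_
  simpa only [abs_sq] using hf.summable

/-- The influence function of the standardized discrepancy. -/
def influence (t : ℝ) (k : ℕ) : ℝ :=
  ((k : ℝ) - Real.exp t * (if k = 0 then 0 else 1)) / √(Real.exp t - 1 - t)

theorem hasSum_poissonProb_mul_influence (t : ℝ) :
    HasSum (fun k => poissonProb t k * influence t k)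
      ((t - Real.exp t * (1 - Real.exp (-t))) / √(Real.exp t - 1 - t)) := by
  refine (((hasSum_poissonProb_mul_id t).sub
    ((hasSum_poissonProb_mul_indicator t).mul_left (Real.exp t))).div_const _).congr_fun fun k => ?_
  unfold influence; ring

theorem hasSum_poissonProb_mul_influence_sq {t : ℝ} (ht : 0 < t) :
    HasSum (fun k => poissonProb t k * influence t k ^ 2)
      ((t * (t + 1) - 2 * Real.exp t * t + Real.exp t ^ 2 * (1 - Real.exp (-t))) /
        (Real.exp t - 1 - t)) := by
  refine ((((hasSum_poissonProb_mul_sq t).sub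
    ((hasSum_poissonProb_mul_id t).mul_left (2 * Real.exp t))).add
    ((hasSum_poissonProb_mul_indicator t).mul_left (Real.exp t ^ 2))).div_const _).congr_fun
    fun k => ?_
  unfold influence
  rw [div_pow, Real.sq_sqrt (exp_sub_one_sub_pos ht.ne').le]
  split_ifs with hk
  · subst hk; simp
  · ring

/-- The numerator k - e^t 1[k ≠ 0] has variance e^t - 1 - t, the square of the denominator. -/
theorem variance_influence {t : ℝ} (ht : 0 < t) : Var[influence t; law t 0] = 1 := by
  have := isProbabilityMeasure_law (isParam_zero ht)
  have hE := exp_sub_one_sub_pos ht.ne'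
  rw [variance_eq_sub (memLp_two_law_zero ht (hasSum_poissonProb_mul_influence_sq ht)),
    integral_law_zero ht (hasSum_poissonProb_mul_influence t)]
  simp only [Pi.pow_apply]
  rw [integral_law_zero ht (hasSum_poissonProb_mul_influence_sq ht), div_pow,
    Real.sq_sqrt hE.le, ← sub_div, div_eq_one_iff_eq hE.ne', Real.exp_neg]
  field_simp
  ring

/-! ### Linearization of the discrepancy. -/

/-- Because G vanishes at x, continuity of c suffices; thus σ need not be differentiated. -/
theorem hasFDerivAt_mul_of_eq_zero {E : Type*} [NormedAddCommGroup E] [NormedSpace ℝ E]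
    {c G : E → ℝ} {G' : E →L[ℝ] ℝ} {x : E} (hc : ContinuousAt c x) (hG : HasFDerivAt G G' x)
    (h0 : G x = 0) : HasFDerivAt (fun y => c y * G y) (c x • G') x := by
  rw [hasFDerivAt_iff_isLittleO] at hG ⊢
  have h1 := (hc.isBigO_one ℝ).mul_isLittleO hG.norm_right
  have h2 : (fun y => c y - c x) =o[nhds x] fun _ => (1 : ℝ) :=
    (Asymptotics.isLittleO_one_iff ℝ).2 (by simpa using hc.tendsto.sub_const (c x))
  have h3 := h2.mul_isBigO (G'.isBigO_sub (nhds x) x).norm_right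
  have h4 := h1.add h3
  simp only [one_mul] at h4
  refine h4.of_norm_right.congr_left fun y => ?_
  rw [h0, smul_apply, smul_eq_mul]
  ring

/-- Near the population values, the standardized discrepancy at the maximum likelihood estimate is a
differentiable function of the sample mean and the proportion of nonzero observations. -/
theorem exists_discrepancy_linearization {l : ℝ} (hl : 0 < l) :
    ∃ F : ℝ × ℝ → ℝ,
      HasFDerivAt F ((√(Real.exp l - 1 - l))⁻¹ •
        (ContinuousLinearMap.fst ℝ ℝ ℝ - Real.exp l • ContinuousLinearMap.snd ℝ ℝ ℝ))
        (l, 1 - Real.exp (-l)) ∧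
      F (l, 1 - Real.exp (-l)) = 0 ∧
      ∀ᶠ x in nhds (l, 1 - Real.exp (-l)), ∀ (n : ℕ) (y : Fin n → ℕ),
        (((∑ i, y i : ℕ) : ℝ) / n,
          ((Finset.univ.filter fun i => ¬ y i = 0).card : ℝ) / n) = x →
        (∃ t p, IsMLE y t p) ∧ ∀ t p, IsMLE y t p → discrepancy t p / sigma t = F x := by
  have hb := one_sub_exp_neg_pos hl
  have hnum := truncMean_deriv_numerator_pos hl
  have hE := exp_sub_one_sub_pos hl.ne'
  have hκ := skellam_gap_pos hl
  have hstrict := hasStrictDerivAt_truncMean hl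
  have hne : (1 - Real.exp (-l) - l * Real.exp (-l)) / (1 - Real.exp (-l)) ^ 2 ≠ 0 :=
    (div_pos hnum (pow_pos hb 2)).ne'
  -- Local inverse of `truncMean`: it turns mean / proportion into λ̂.
  obtain ⟨g, hg, hgl, hgr⟩ : ∃ g : ℝ → ℝ, HasDerivAt g
      ((1 - Real.exp (-l) - l * Real.exp (-l)) / (1 - Real.exp (-l)) ^ 2)⁻¹ (truncMean l) ∧
      g (truncMean l) = l ∧ ∀ᶠ x in nhds (truncMean l), truncMean (g x) = x :=
    ⟨_, (hstrict.to_localInverse hne).hasDerivAt,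
      HasStrictFDerivAt.localInverse_apply_image _, hstrict.eventually_right_inverse hne⟩
  have hr0 : l / (1 - Real.exp (-l)) = truncMean l := rfl
  have hratio : HasFDerivAt (fun x : ℝ × ℝ => x.1 / x.2)
      ((1 - Real.exp (-l))⁻¹ • ContinuousLinearMap.fst ℝ ℝ ℝ -
        (l / (1 - Real.exp (-l)) ^ 2) • ContinuousLinearMap.snd ℝ ℝ ℝ) (l, 1 - Real.exp (-l)) := by
    have h := (hasFDerivAt_fst (𝕜 := ℝ) (p := (l, 1 - Real.exp (-l)))).mul
      (HasDerivAt.comp_hasFDerivAt (h₂ := fun x : ℝ => x⁻¹) (l, 1 - Real.exp (-l))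
        (hasDerivAt_inv hb.ne') (hasFDerivAt_snd (𝕜 := ℝ) (p := (l, 1 - Real.exp (-l)))))
    refine h.congr_fderiv (ContinuousLinearMap.ext fun v => ?_)
    simp only [smul_apply, sub_apply, add_apply, ContinuousLinearMap.coe_fst',
      ContinuousLinearMap.coe_snd', smul_eq_mul, Function.comp_apply]
    field_simp
    ring
  have hgc : HasFDerivAt (fun x : ℝ × ℝ => g (x.1 / x.2)) _ (l, 1 - Real.exp (-l)) :=
    HasDerivAt.comp_hasFDerivAt (h₂ := g) (l, 1 - Real.exp (-l)) hg hratio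
  have hC := hasDerivAt_poissonMin_div_sq hl
  have hC1 : HasFDerivAt (fun x : ℝ × ℝ => poissonMin x.1 / x.1 ^ 2) _ (l, 1 - Real.exp (-l)) :=
    HasDerivAt.comp_hasFDerivAt (h₂ := fun x => poissonMin x / x ^ 2) (l, 1 - Real.exp (-l)) hC
      (hasFDerivAt_fst (𝕜 := ℝ) (p := (l, 1 - Real.exp (-l))))
  have hC2 : HasFDerivAt (fun x : ℝ × ℝ => poissonMin (g (x.1 / x.2)) / g (x.1 / x.2) ^ 2) _
      (l, 1 - Real.exp (-l)) :=
    HasDerivAt.comp_hasFDerivAt (h₂ := fun x => poissonMin x / x ^ 2) (l, 1 - Real.exp (-l))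
      (by simpa only [hr0, hgl] using hC) hgc
  have hzero : poissonMin l / l ^ 2 - poissonMin (g (l / (1 - Real.exp (-l)))) /
      g (l / (1 - Real.exp (-l))) ^ 2 = 0 := by rw [hr0, hgl, sub_self]
  have hc : ContinuousAt (fun x : ℝ × ℝ => x.1 ^ 2 / sigma x.1) (l, 1 - Real.exp (-l)) :=
    (by fun_prop : ContinuousAt (fun x : ℝ × ℝ => x.1 ^ 2) _).div
      (ContinuousAt.comp (g := sigma) (continuousAt_sigma hl) continuousAt_fst) (sigma_pos hl).ne'
  refine ⟨fun x => x.1 ^ 2 / sigma x.1 * (poissonMin x.1 / x.1 ^ 2 -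
    poissonMin (g (x.1 / x.2)) / g (x.1 / x.2) ^ 2), ?_, ?_, ?_⟩
  · refine (hasFDerivAt_mul_of_eq_zero hc (hC1.sub hC2) hzero).congr_fderiv ?_
    have hs := Real.sqrt_pos.2 hE
    have hss := Real.sq_sqrt hE.le
    have hexp := (Real.exp_pos l).ne'
    have hsig := sigma_eq hl
    have hE1 : 1 - Real.exp (-l) - l * Real.exp (-l) = √(Real.exp l - 1 - l) ^ 2 / Real.exp l := by
      rw [hss, Real.exp_neg]; field_simp
    refine ContinuousLinearMap.ext fun v => ?_
    simp only [smul_apply, sub_apply, ContinuousLinearMap.coe_fst',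
      ContinuousLinearMap.coe_snd', smul_eq_mul]
    rw [hsig, hE1]
    have hbe : Real.exp l * (1 - Real.exp (-l)) = √(Real.exp l - 1 - l) ^ 2 + l := by
      rw [hss, mul_sub, ← Real.exp_add]; simp
    generalize √(Real.exp l - 1 - l) = s at *
    generalize 1 - skellamProb l 0 - 2 * skellamProb l 1 = k at *
    generalize 1 - Real.exp (-l) = b at *
    generalize Real.exp l = e at *
    clear hss
    field_simp
    linear_combination v.1 * hbe
  · simp only [hzero, mul_zero]
  · have hratio' : Tendsto (fun x : ℝ × ℝ => x.1 / x.2) (nhds (l, 1 - Real.exp (-l)))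
        (nhds (truncMean l)) := hratio.continuousAt.tendsto
    -- The four open conditions say: g solves the likelihood equation, λ̂ > 0, some observation is
    -- nonzero, some is zero.
    have e1 := hratio'.eventually hgr
    have e2 : ∀ᶠ x : ℝ × ℝ in nhds (l, 1 - Real.exp (-l)), 0 < g (x.1 / x.2) := by
      refine hgc.continuousAt.tendsto.eventually_const_lt ?_
      change 0 < g (truncMean l)
      rwa [hgl]
    have e3 : ∀ᶠ x : ℝ × ℝ in nhds (l, 1 - Real.exp (-l)), 0 < x.2 :=
      continuousAt_snd.tendsto.eventually_const_lt hb
    have e4 : ∀ᶠ x : ℝ × ℝ in nhds (l, 1 - Real.exp (-l)), x.2 < 1 :=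
      continuousAt_snd.tendsto.eventually_lt_const (by linarith [Real.exp_pos (-l)])
    filter_upwards [e1, e2, e3, e4] with x h1 h2 h3 h4 n y hxy
    subst hxy
    simp only at h1 h2 h3 h4
    have hn : n ≠ 0 := by rintro rfl; simp at h3
    have hn' : (0 : ℝ) < n := by exact_mod_cast Nat.pos_of_ne_zero hn
    have hm : (Finset.univ.filter fun i => ¬ y i = 0).card ≠ 0 := by
      intro h; rw [h] at h3; simp at h3
    have hz : (Finset.univ.filter fun i => y i = 0).card ≠ 0 := by
      intro h
      have := Finset.card_filter_add_card_filter_not (s := (Finset.univ : Finset (Fin n)))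
        (fun i => y i = 0)
      rw [h, zero_add, Finset.card_univ, Fintype.card_fin] at this
      rw [this, div_self hn'.ne'] at h4
      exact lt_irrefl _ h4
    obtain ⟨hex, huniq⟩ := mle_exists_and_eq y hz hm h2 (by
      rw [h1, div_div_div_cancel_right₀ hn'.ne'])
    refine ⟨hex, fun t p hM => ?_⟩
    obtain ⟨ht, hl'⟩ := huniq t p hM
    rw [discrepancy_eq hM.1, hl', ← ht]
    ring

end ZIP

/-! ### The limit theorem. -/

theorem theorem1 {Ω : Type*} [MeasurableSpace Ω] (P : Measure Ω) [IsProbabilityMeasure P]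
    (θ : ℝ) (hθ : 0 < θ)
    (Y : ℕ → Ω → ℕ)
    (hindep : iIndepFun Y P)
    (hlaw : ∀ i, HasLaw (Y i) (ZIP.law θ 0) P)
    (thetaHat pHat : (n : ℕ) → (Fin n → ℕ) → ℝ)
    (hMLE : ∀ (n : ℕ) (y : Fin n → ℕ),
      (∃ t q : ℝ, ZIP.IsMLE y t q) → ZIP.IsMLE y (thetaHat n y) (pHat n y)) :
    TendstoInDistribution
      (fun (n : ℕ) (ω : Ω) =>
        Real.sqrt n *
          (ZIP.discrepancy (thetaHat n fun i => Y i ω) (pHat n fun i => Y i ω) /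
            ZIP.sigma (thetaHat n fun i => Y i ω)))
      atTop (id : ℝ → ℝ) (fun _ => P) (gaussianReal 0 1) := by
  have := ZIP.isProbabilityMeasure_law (ZIP.isParam_zero hθ)
  have hident : ∀ (f : ℕ → ℝ) (i : ℕ),
      IdentDistrib (fun ω => f (Y i ω)) (fun ω => f (Y 0 ω)) P P := fun f i =>
    ((hlaw i).identDistrib (hlaw 0)).comp (u := f) (by fun_prop)
  have hind : ∀ f : ℕ → ℝ, iIndepFun (fun i ω => f (Y i ω)) P := fun f =>
    hindep.comp (fun _ => f) fun _ => by fun_prop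
  have hLp : ∀ {f : ℕ → ℝ} {c : ℝ}, HasSum (fun k => ZIP.poissonProb θ k * f k ^ 2) c →
      MemLp (fun ω => f (Y 0 ω)) 2 P := fun {f c} h => by
    have h2 := ZIP.memLp_two_law_zero hθ h
    rw [← (hlaw 0).map_eq] at h2
    exact h2.comp_of_map (hlaw 0).aemeasurable
  have hint : ∀ {f : ℕ → ℝ} {c : ℝ}, HasSum (fun k => ZIP.poissonProb θ k * f k) c →
      ∫ ω, f (Y 0 ω) ∂P = c := fun {f c} h =>
    ((hlaw 0).integral_comp (f := f) (by fun_prop)).trans (ZIP.integral_law_zero hθ h)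
  have hinf := ZIP.hasSum_poissonProb_mul_influence θ
  have hvar : Var[fun ω => ZIP.influence θ (Y 0 ω); P] = 1 := by
    rw [← ZIP.variance_influence hθ, ← (hlaw 0).map_eq,
      variance_map (by fun_prop) (hlaw 0).aemeasurable]
    rfl
  have hclt := tendstoInDistribution_inv_sqrt_mul_sum_sub (P' := gaussianReal 0 1)
    (X := fun i ω => ZIP.influence θ (Y i ω)) (Y := (id : ℝ → ℝ))
    (by rw [hvar, Real.toNNReal_one]; exact HasLaw.id)
    (hLp (ZIP.hasSum_poissonProb_mul_influence_sq hθ)) (hind _) (hident _)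
  rw [hint hinf] at hclt
  let ind : ℕ → ℝ := fun k => if k = 0 then 0 else 1
  have hid2 := hLp (f := fun k => (k : ℝ)) (ZIP.hasSum_poissonProb_mul_sq θ)
  have hind2 := hLp (f := ind) (c := 1 - Real.exp (-θ)) (by
    simpa [ind, ite_pow] using ZIP.hasSum_poissonProb_mul_indicator θ)
  obtain ⟨F, hF, hF0, hFT⟩ := ZIP.exists_discrepancy_linearization hθ
  let U : ℕ → Ω → ℝ × ℝ := fun n ω =>
    ((∑ i ∈ Finset.range n, (Y i ω : ℝ)) / n, (∑ i ∈ Finset.range n, ind (Y i ω)) / n)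
  -- Slutsky: it remains to show that the statistic differs from the normalized influence sum by
  -- o_P(1).
  refine tendstoInDistribution_of_tendstoInMeasure_sub _ _ hclt ?_ fun n => ?_
  · have hU : ∀ n : ℕ, ∀ c > 0, P.real {ω | c ≤ √n * ‖U n ω - (θ, 1 - Real.exp (-θ))‖} ≤
        (Var[fun ω => (Y 0 ω : ℝ); P] + Var[fun ω => ind (Y 0 ω); P]) / c ^ 2 := by
      intro n c hc
      have h1 := ZIP.measureReal_sqrt_mul_abs_mean_sub_le hid2 (hind _) (hident _) n hc
      have h2 := ZIP.measureReal_sqrt_mul_abs_mean_sub_le hind2 (hind _) (hident _) n hc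
      rw [hint (ZIP.hasSum_poissonProb_mul_id θ)] at h1
      rw [hint (ZIP.hasSum_poissonProb_mul_indicator θ)] at h2
      rw [add_div]
      refine le_trans (measureReal_mono (μ := P) fun ω hω => ?_)
        ((measureReal_union_le _ _).trans (add_le_add h1 h2))
      have h3 : c ≤ √n * ‖U n ω - (θ, 1 - Real.exp (-θ))‖ := hω
      -- In the sup norm a large deviation occurs in one of the two coordinates.
      rw [Prod.norm_def, mul_max_of_nonneg _ _ (Real.sqrt_nonneg _), le_max_iff] at h3
      exact h3
    have hlin := ZIP.tendstoInMeasure_sub_linearization hU hF hF0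
      (T := fun n ω => √n * (ZIP.discrepancy (thetaHat n fun i => Y i ω) (pHat n fun i => Y i ω) /
            ZIP.sigma (thetaHat n fun i => Y i ω))) (by
        filter_upwards [hFT] with x hx n ω hUx
        obtain ⟨hex, heq⟩ := hx n (fun i => Y i ω) (by
          rw [← hUx]
          simp only [U, ind]
          rw [Nat.cast_sum, Fin.sum_univ_eq_sum_range (fun i => (Y i ω : ℝ)),
            ← Fin.sum_univ_eq_sum_range (fun i => if Y i ω = 0 then (0 : ℝ) else 1)]
          congr 2
          simp [Finset.sum_ite])
        rw [heq _ _ (hMLE n _ hex)])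
    convert! hlin using 1
    funext n ω
    rw [Pi.sub_apply, Pi.sub_apply]
    congr 1
    simp only [U, ZIP.influence]
    rcases Nat.eq_zero_or_pos n with rfl | hn
    · simp
    have hn' : (0 : ℝ) < n := by exact_mod_cast hn
    have hs := Real.sqrt_pos.2 hn'
    have hss := Real.mul_self_sqrt hn'.le
    have hE := Real.sqrt_pos.2 (ZIP.exp_sub_one_sub_pos hθ.ne')
    rw [← Finset.sum_div, Finset.sum_sub_distrib, ← Finset.mul_sum]
    simp only [smul_eq_mul, smul_apply, sub_apply,
      ContinuousLinearMap.coe_fst', ContinuousLinearMap.coe_snd', Prod.fst_sub, Prod.snd_sub]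
    change (√(n : ℝ))⁻¹ * ((∑ i ∈ Finset.range n, (Y i ω : ℝ) -
      Real.exp θ * ∑ i ∈ Finset.range n, ind (Y i ω)) / _ - _) = _
    generalize √(n : ℝ) = s at *
    rw [← hss]
    field_simp
    ring
  · refine AEMeasurable.const_mul ?_ _
    -- The sample space is countable, so arbitrary choices of estimator are measurable.
    exact (measurable_of_countable fun y : Fin n → ℕ =>
      ZIP.discrepancy (thetaHat n y) (pHat n y) / ZIP.sigma (thetaHat n y)).comp_aemeasurable
      (aemeasurable_pi_lambda _ fun i => (hlaw i).aemeasurable)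

end
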